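/- Let $\alpha,\nu>0$ and let $n>\nu$ be a natural number, and put $R=2\log(n/\nu)$. On the hyperbolic plane $\mathbb{H}$ of curvature $-1$, with polar coordinates $(r,\theta)$ around a fixed origin, the $(\alpha,R)$-quasi-uniform distribution is the probability distribution with density $$\frac{\alpha\sinh(\alpha r)}{2\pi(\cosh(\alpha R)-1)},\qquad 0\le r<R,\ 0<\theta\le 2\pi,$$ with respect to $dr\,d\theta$. Let $G_{\mathrm{Po}}(n;\alpha,\nu)$ be the random graph whose vertices are $p_1,\dots,p_Z$, where $p_1,p_2,\dots$ are i.i.d. points with this distribution and $Z$ is a Poisson random variable with mean $n$ that is independent of them (equivalently, the vertices form a Poisson point process whose intensity is $n$ times this distribution), and in which two distinct vertices are adjacent if and only if their hyperbolic distance is at most $R$. A near perfect matching of a graph is a set of edges, no two of which share an endpoint, that covers all but at most one of the vertices. **Theorem.** For every real $\alpha$ with $0<\alpha<\tfrac12$ there is a $\nu_0=\nu_0(\alpha)>0$ such that for every $0<\nu<\nu_0$, $$\mathbb{P}\bigl(G_{\mathrm{Po}}(n;\alpha,\nu)\text{ has no near perfect matching}\bigr)=1-o(n^{-1/2})\qquad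 (n\to\infty).$$ -/

import Mathlib

open MeasureTheory ProbabilityTheory Filter Asymptotics

namespace KPKVB

noncomputable section

/-! ### Hyperbolic polar coordinates

The hyperbolic plane (curvature `-1`) is Mathlib's upper half-plane with its hyperbolic metric.
The point with polar coordinates `(r, θ)` is `tanh (r / 2) * exp (θ * I)` in the Poincaré disk,
carried to the half-plane by the Cayley isometry `w ↦ I * (1 + w) / (1 - w)`. -/

/-- The point of the Poincaré disk (as a complex number) with polar coordinates `(r, θ)`. -/
def diskPoint (r θ : ℝ) : ℂ := (Real.tanh (r / 2) : ℂ) * Complex.exp (θ * Complex.I)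

lemma diskPoint_re (r θ : ℝ) : (diskPoint r θ).re = Real.tanh (r / 2) * Real.cos θ := by
  rw [diskPoint, Complex.re_ofReal_mul, Complex.exp_ofReal_mul_I_re]

lemma diskPoint_im (r θ : ℝ) : (diskPoint r θ).im = Real.tanh (r / 2) * Real.sin θ := by
  rw [diskPoint, Complex.im_ofReal_mul, Complex.exp_ofReal_mul_I_im]

lemma normSq_diskPoint_lt_one (r θ : ℝ) : Complex.normSq (diskPoint r θ) < 1 := by
  have h1 := Real.tanh_lt_one (r / 2)
  have h2 := Real.neg_one_lt_tanh (r / 2)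
  rw [Complex.normSq_apply, diskPoint_re, diskPoint_im]
  have h3 : Real.tanh (r / 2) * Real.cos θ * (Real.tanh (r / 2) * Real.cos θ)
      + Real.tanh (r / 2) * Real.sin θ * (Real.tanh (r / 2) * Real.sin θ)
      = Real.tanh (r / 2) ^ 2 := by
    linear_combination (Real.tanh (r / 2)) ^ 2 * Real.sin_sq_add_cos_sq θ
  rw [h3]
  nlinarith

lemma cayley_im_pos {w : ℂ} (hw : Complex.normSq w < 1) :
    0 < (Complex.I * (1 + w) / (1 - w)).im := by
  have hne : 1 - w ≠ 0 := by
    intro h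
    rw [← sub_eq_zero.1 h] at hw
    simp at hw
  have hpos : 0 < Complex.normSq (1 - w) := Complex.normSq_pos.2 hne
  have : (Complex.I * (1 + w) / (1 - w)).im
      = (1 - Complex.normSq w) / Complex.normSq (1 - w) := by
    rw [Complex.div_im]
    simp [Complex.normSq_apply]
    field_simp
    ring
  rw [this]
  exact div_pos (by linarith) hpos

/-- The point of the hyperbolic plane with hyperbolic polar coordinates `p = (r, θ)`. -/
def polarPoint (p : ℝ × ℝ) : UpperHalfPlane :=
  ⟨Complex.I * (1 + diskPoint p.1 p.2) / (1 - diskPoint p.1 p.2),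
    cayley_im_pos (normSq_diskPoint_lt_one p.1 p.2)⟩

lemma polarPoint_coords (r θ : ℝ) :
    (polarPoint (r, θ)).im = 1 / (Real.cosh r - Real.sinh r * Real.cos θ) ∧
    (polarPoint (r, θ)).re = - (Real.sinh r * Real.sin θ) / (Real.cosh r - Real.sinh r * Real.cos θ)
    ∧ 0 < Real.cosh r - Real.sinh r * Real.cos θ := by
  have hc : 0 < Real.cosh (r / 2) := Real.cosh_pos _
  have hr : r = 2 * (r / 2) := by ring
  have h1 := Real.cosh_sq (r / 2)
  have h4 := Real.sin_sq_add_cos_sq θ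
  have hd : 0 < Real.cosh r - Real.sinh r * Real.cos θ := by
    have h2 := Real.cosh_sq r
    have h3 := Real.cosh_pos r
    by_contra! h
    have h5 : (Real.sinh r * Real.cos θ) ^ 2 ≤ Real.sinh r ^ 2 := by
      rw [mul_pow]
      nlinarith [sq_nonneg (Real.sinh r), sq_nonneg (Real.sin θ),
        mul_nonneg (sq_nonneg (Real.sinh r)) (sq_nonneg (Real.sin θ))]
    nlinarith
  have hN : Complex.normSq (1 - diskPoint r θ)
      = (Real.cosh r - Real.sinh r * Real.cos θ) / Real.cosh (r / 2) ^ 2 := by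
    rw [Complex.normSq_apply]
    simp only [Complex.sub_re, Complex.sub_im, Complex.one_re, Complex.one_im, diskPoint_re,
      diskPoint_im, Real.tanh_eq_sinh_div_cosh]
    have e1 : Real.cosh r = Real.cosh (r / 2) ^ 2 + Real.sinh (r / 2) ^ 2 := by
      conv_lhs => rw [hr, Real.cosh_two_mul]
    have e2 : Real.sinh r = 2 * Real.sinh (r / 2) * Real.cosh (r / 2) := by
      conv_lhs => rw [hr, Real.sinh_two_mul]
    rw [e1, e2]
    field_simp
    linear_combination Real.sinh (r / 2) ^ 2 * h4
  have e2 : Real.sinh r = 2 * Real.sinh (r / 2) * Real.cosh (r / 2) := by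
    conv_lhs => rw [hr, Real.sinh_two_mul]
  refine ⟨?_, ?_, hd⟩
  · change (Complex.I * (1 + diskPoint r θ) / (1 - diskPoint r θ)).im = _
    rw [Complex.div_im, hN]
    simp only [Complex.mul_re, Complex.mul_im, Complex.sub_re, Complex.sub_im, Complex.add_re,
      Complex.add_im, Complex.I_re, Complex.I_im, Complex.one_re, Complex.one_im, diskPoint_re,
      diskPoint_im, Real.tanh_eq_sinh_div_cosh]
    generalize Real.cosh r - Real.sinh r * Real.cos θ = D at hd ⊢
    have hd' := hd.ne'
    field_simp
    linear_combination h1 - Real.sinh (r / 2) ^ 2 * h4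
  · change (Complex.I * (1 + diskPoint r θ) / (1 - diskPoint r θ)).re = _
    rw [Complex.div_re, hN, e2]
    simp only [Complex.mul_re, Complex.mul_im, Complex.sub_re, Complex.sub_im, Complex.add_re,
      Complex.add_im, Complex.I_re, Complex.I_im, Complex.one_re, Complex.one_im, diskPoint_re,
      diskPoint_im, Real.tanh_eq_sinh_div_cosh]
    rw [e2] at hd
    field_simp
    ring_nf

/-- The hyperbolic law of cosines. -/
lemma cosh_dist_polarPoint (p q : ℝ × ℝ) :
    Real.cosh (dist (polarPoint p) (polarPoint q)) =
      Real.cosh p.1 * Real.cosh q.1 - Real.sinh p.1 * Real.sinh q.1 * Real.cos (p.2 - q.2) := by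
  obtain ⟨r, θ⟩ := p
  obtain ⟨r', θ'⟩ := q
  obtain ⟨h1, h2, h3⟩ := polarPoint_coords r θ
  obtain ⟨h1', h2', h3'⟩ := polarPoint_coords r' θ'
  rw [UpperHalfPlane.cosh_dist', h1, h2, h1', h2', Real.cos_sub]
  have a := Real.cosh_sq r
  have a' := Real.cosh_sq r'
  have b := Real.sin_sq_add_cos_sq θ
  have b' := Real.sin_sq_add_cos_sq θ'
  dsimp only
  generalize Real.cosh r = c at *
  generalize Real.cosh r' = c' at *
  generalize Real.sinh r = s at *
  generalize Real.sinh r' = s' at *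
  generalize Real.cos θ = x at *
  generalize Real.cos θ' = x' at *
  generalize Real.sin θ = y at *
  generalize Real.sin θ' = y' at *
  have e : (s * y) ^ 2 + 1 = (c - s * x) * (c + s * x) := by linear_combination s ^ 2 * b - a
  have e' : (s' * y') ^ 2 + 1 = (c' - s' * x') * (c' + s' * x') := by
    linear_combination s' ^ 2 * b' - a'
  have hD := h3.ne'
  have hD' := h3'.ne'
  field_simp
  linear_combination (c' - s' * x') ^ 2 * e + (c - s * x) ^ 2 * e'

/-- The coordinate `r` is the hyperbolic distance to the origin. -/
lemma dist_polarPoint_origin {r : ℝ} (hr : 0 ≤ r) (θ θ₀ : ℝ) :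
    dist (polarPoint (r, θ)) (polarPoint (0, θ₀)) = r := by
  have h := cosh_dist_polarPoint (r, θ) (0, θ₀)
  simp only [Real.cosh_zero, Real.sinh_zero, mul_one, mul_zero, zero_mul, sub_zero] at h
  exact Real.cosh_strictMonoOn.injOn dist_nonneg hr h

/-! ### The Poissonised KPKVB random graph -/

/-- `R = 2 log (n / ν)`. -/
def radius (n : ℕ) (ν : ℝ) : ℝ := 2 * Real.log (n / ν)

/-- The density of the quasi-uniform distribution with respect to `dr dθ`, on
`0 ≤ r < R`, `0 < θ ≤ 2π`. -/
def density (α R : ℝ) (p : ℝ × ℝ) : ℝ :=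
  (Set.Ico 0 R ×ˢ Set.Ioc 0 (2 * Real.pi)).indicator
    (fun q => α * Real.sinh (α * q.1) / (2 * Real.pi * (Real.cosh (α * R) - 1))) p

/-- The `(α, R)`-quasi uniform distribution, as a law of polar coordinates `(r, θ)`. -/
def quasiUniform (α R : ℝ) : Measure (ℝ × ℝ) :=
  volume.withDensity fun p => ENNReal.ofReal (density α R p)

lemma isProbabilityMeasure_quasiUniform {α R : ℝ} (hα : 0 < α) (hR : 0 < R) :
    IsProbabilityMeasure (quasiUniform α R) := by
  have hC : 0 < Real.cosh (α * R) - 1 := by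
    have := Real.one_lt_cosh.2 (mul_pos hα hR).ne'
    linarith
  constructor
  have hpi := Real.pi_pos
  have hI : Integrable (fun q : ℝ => α * Real.sinh (α * q)) (volume.restrict (Set.Ico 0 R)) :=
    ((by fun_prop : Continuous fun q : ℝ => α * Real.sinh (α * q)).integrableOn_Icc
      (a := 0) (b := R)).mono_set Set.Ico_subset_Icc_self
  have hint : ∫ q in Set.Ico 0 R, α * Real.sinh (α * q) = Real.cosh (α * R) - 1 := by
    rw [integral_Ico_eq_integral_Ioc, ← intervalIntegral.integral_of_le hR.le]
    rw [intervalIntegral.integral_eq_sub_of_hasDerivAt (f := fun q => Real.cosh (α * q))]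
    · simp
    · intro x _
      have := ((hasDerivAt_id x).const_mul α).cosh
      simpa [mul_comm] using this
    · exact (by fun_prop : Continuous fun q : ℝ => α * Real.sinh (α * q)).intervalIntegrable _ _
  rw [quasiUniform, withDensity_apply _ .univ, Measure.restrict_univ]
  have : (fun p : ℝ × ℝ => ENNReal.ofReal (density α R p)) =
      (Set.Ico 0 R ×ˢ Set.Ioc 0 (2 * Real.pi)).indicator (fun q : ℝ × ℝ =>
        ENNReal.ofReal (α * Real.sinh (α * q.1)) *
        ENNReal.ofReal (1 / (2 * Real.pi * (Real.cosh (α * R) - 1)))) := by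
    funext p
    by_cases hp : p ∈ Set.Ico 0 R ×ˢ Set.Ioc 0 (2 * Real.pi)
    · have h0 : 0 ≤ α * Real.sinh (α * p.1) :=
        mul_nonneg hα.le (Real.sinh_nonneg_iff.2 (mul_nonneg hα.le hp.1.1))
      rw [density, Set.indicator_of_mem hp, Set.indicator_of_mem hp, ← ENNReal.ofReal_mul h0]
      congr 1
      ring
    · rw [density, Set.indicator_of_notMem hp, Set.indicator_of_notMem hp, ENNReal.ofReal_zero]
  rw [this, lintegral_indicator (measurableSet_Ico.prod measurableSet_Ioc),
    Measure.volume_eq_prod, ← Measure.prod_restrict,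
    lintegral_prod_mul (f := fun q : ℝ => ENNReal.ofReal (α * Real.sinh (α * q)))
      (g := fun _ : ℝ => ENNReal.ofReal (1 / (2 * Real.pi * (Real.cosh (α * R) - 1))))
      (by fun_prop) (by fun_prop),
    ← ofReal_integral_eq_lintegral_ofReal hI, hint, lintegral_const, Measure.restrict_apply_univ,
    Real.volume_Ioc, sub_zero, ← ENNReal.ofReal_mul (by positivity),
    ← ENNReal.ofReal_mul hC.le, ← ENNReal.ofReal_one]
  · congr 1
    field_simp
  · refine (ae_restrict_iff' measurableSet_Ico).2 (ae_of_all _ fun x hx => ?_)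
    exact mul_nonneg hα.le (Real.sinh_nonneg_iff.2 (mul_nonneg hα.le hx.1))

/-- The probability measure carrying a Poisson variable `Z` of mean `n` and, independently of it,
an infinite sequence of i.i.d. quasi-uniform points `p 0, p 1, …`; a sample is `(Z, p)`. The points
`p 0, …, p (Z - 1)` form the Poisson point process of total intensity `n`. -/
def poissonLaw (n : ℕ) (α ν : ℝ) : Measure (ℕ × (ℕ → ℝ × ℝ)) :=
  (poissonMeasure (n : NNReal)).prod
    (Measure.infinitePi fun _ : ℕ => quasiUniform α (radius n ν))

/-- The graph of a sample: the vertices are (the indices of) the points `p 0, …, p (Z - 1)`, and two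
of them are adjacent when they are at hyperbolic distance at most `R`. -/
def poissonGraph (R : ℝ) (ω : ℕ × (ℕ → ℝ × ℝ)) : SimpleGraph (Fin ω.1) where
  Adj i j := i ≠ j ∧ dist (polarPoint (ω.2 i)) (polarPoint (ω.2 j)) ≤ R
  symm := ⟨fun _ _ h => ⟨h.1.symm, by rw [dist_comm]; exact h.2⟩⟩
  loopless := ⟨fun _ h => h.1 rfl⟩

/-- A near perfect matching is a matching that covers all but at most one vertex. -/
def HasNearPerfectMatching {V : Type*} (G : SimpleGraph V) : Prop :=
  ∃ M : G.Subgraph, M.IsMatching ∧ (M.verts)ᶜ.Subsingleton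

end

end KPKVB

open scoped ENNReal

namespace KPKVB

noncomputable section

/-! ### Matchings and vertex covers -/

/-! A near perfect matching forces every vertex cover to contain about half of the vertices. So it
suffices to find a vertex cover that is much smaller with overwhelming probability.

Fix a depth `h` depending only on `α`. Few points have radius at most `R - h`, a fraction about `exp
(-α h)`. Two adjacent points beyond that radius have almost equal angles, within order `exp h * ν /
n`. Reveal the points one by one and mark those that are deep, or whose angle is close to that of an
earlier point. The marked points cover all edges. With at most `2n` points and `ν` small compared
with `exp (-h)`, each point is marked with conditional probability at most 1/255, so half of `m`
points are marked with probability at most `16 * 8 ^ (-m)` (`measure_half_marked_le`). Averaging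
over the Poisson number of points (`poissonLaw_le_of_slice_le`) leaves an exponentially small bound,
stronger than the one required. -/

lemma HasNearPerfectMatching.card_le {V : Type*} [Fintype V] {G : SimpleGraph V}
    (h : HasNearPerfectMatching G) (T : Finset V) (hT : ∀ u v, G.Adj u v → u ∈ T ∨ v ∈ T) :
    Fintype.card V ≤ 2 * T.card + 1 := by
  classical
  obtain ⟨M, hM, hsub⟩ := h
  -- An unmatched vertex gets itself as a dummy partner.
  have hmate : ∀ v : V, ∃ w, v ∈ M.verts → M.Adj v w := fun v => by
    by_cases hv : v ∈ M.verts
    · obtain ⟨w, hw, -⟩ := hM hv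
      exact ⟨w, fun _ => hw⟩
    · exact ⟨v, fun h => (hv h).elim⟩
  choose f hf using hmate
  -- Matched vertices outside `T` have their partners in `T`, and distinct vertices have distinct
  -- partners.
  have h1 : ((Finset.univ.filter (· ∈ M.verts)) \ T).card ≤ T.card := by
    refine Finset.card_le_card_of_injOn f ?_ ?_
    · intro v hv
      simp only [Finset.coe_sdiff, Finset.coe_filter, Finset.mem_univ, true_and, Set.mem_sdiff,
        Set.mem_ofPred_eq, Finset.mem_coe] at hv
      exact (hT v (f v) (hf v hv.1).adj_sub).resolve_left hv.2
    · intro u hu v hv huv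
      simp only [Finset.coe_sdiff, Finset.coe_filter, Finset.mem_univ, true_and, Set.mem_sdiff,
        Set.mem_ofPred_eq, Finset.mem_coe] at hu hv
      have hu' := hf u hu.1
      have hv' := hf v hv.1
      rw [← huv] at hv'
      exact (hM (M.edge_vert hu'.symm)).unique hu'.symm hv'.symm
  have h2 : (Finset.univ.filter (· ∉ M.verts)).card ≤ 1 := by
    rw [Finset.card_le_one]
    intro u hu v hv
    exact hsub (by simpa using hu) (by simpa using hv)
  have h3 : (Finset.univ.filter (· ∈ M.verts)).card ≤
      ((Finset.univ.filter (· ∈ M.verts)) \ T).card + T.card := by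
    rw [Finset.card_sdiff_add_card]
    exact Finset.card_le_card Finset.subset_union_left
  have h4 := Finset.card_filter_add_card_filter_not (s := (Finset.univ : Finset V)) (· ∈ M.verts)
  rw [Finset.card_univ] at h4
  omega

/-! ### Exploring an i.i.d. sequence -/

section Exploration

variable {Ω : Type*}

/-- The `j`-th point lies in `A` or is in relation `C` with an earlier point. -/
def IsMarked (A : Set Ω) (C : Set (Ω × Ω)) {m : ℕ} (x : Fin m → Ω) (j : Fin m) : Prop :=
  x j ∈ A ∨ ∃ i < j, (x i, x j) ∈ C

open Classical in
/-- The number `256 ^ k`, where `k` is the number of marked points. -/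
def markWeight (A : Set Ω) (C : Set (Ω × Ω)) (m : ℕ) (x : Fin m → Ω) : ℝ≥0∞ :=
  ∏ j, if IsMarked A C x j then 256 else 1

open Classical in
lemma markWeight_eq_pow (A : Set Ω) (C : Set (Ω × Ω)) (m : ℕ) (x : Fin m → Ω) :
    markWeight A C m x = 256 ^ (Finset.univ.filter (IsMarked A C x)).card := by
  rw [markWeight, Finset.prod_ite]
  simp

open Classical in
-- A mark depends only on the point and its predecessors, so appending a point leaves the earlier
-- factors unchanged. This allows the last point to be integrated out first.
lemma markWeight_succ (A : Set Ω) (C : Set (Ω × Ω)) (m : ℕ) (x : Fin m → Ω) (y : Ω) :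
    markWeight A C (m + 1) (Fin.snoc x y) = markWeight A C m x *
      if y ∈ A ∨ ∃ i, (x i, y) ∈ C then 256 else 1 := by
  rw [markWeight, Fin.prod_univ_castSucc, markWeight]
  congr 1
  · refine Finset.prod_congr rfl fun j _ => ?_
    congr 1
    simp only [IsMarked, Fin.snoc_castSucc, eq_iff_iff]
    refine or_congr Iff.rfl ⟨?_, ?_⟩
    · rintro ⟨i, hi, h⟩
      refine ⟨i.castPred (ne_of_lt (hi.trans (Fin.castSucc_lt_last j))), ?_, ?_⟩
      · simpa [Fin.lt_def] using hi
      · rw [← Fin.castSucc_castPred i (ne_of_lt (hi.trans (Fin.castSucc_lt_last j))),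
          Fin.snoc_castSucc] at h
        exact h
    · rintro ⟨i, hi, h⟩
      exact ⟨i.castSucc, by simpa using hi, by simpa using h⟩
  · congr 1
    simp only [IsMarked, Fin.snoc_last, eq_iff_iff]
    refine or_congr Iff.rfl ⟨?_, ?_⟩
    · rintro ⟨i, hi, h⟩
      refine ⟨i.castPred (ne_of_lt hi), ?_⟩
      rw [← Fin.castSucc_castPred i (ne_of_lt hi), Fin.snoc_castSucc] at h
      exact h
    · rintro ⟨i, h⟩
      exact ⟨i.castSucc, Fin.castSucc_lt_last i, by simpa using h⟩

variable [MeasurableSpace Ω]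

lemma measurable_markWeight {A : Set Ω} {C : Set (Ω × Ω)} (hA : MeasurableSet A)
    (hC : MeasurableSet C) (m : ℕ) : Measurable (markWeight A C m) := by
  classical
  refine Finset.measurable_prod _ fun j _ => ?_
  refine Measurable.ite ?_ measurable_const measurable_const
  have h1 : MeasurableSet {x : Fin m → Ω | x j ∈ A} := hA.preimage (measurable_pi_apply j)
  have h2 : ∀ i, MeasurableSet {x : Fin m → Ω | i < j ∧ (x i, x j) ∈ C} := fun i =>
    (MeasurableSet.const _).inter
      (hC.preimage ((measurable_pi_apply i).prodMk (measurable_pi_apply j)))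
  have := h1.union (MeasurableSet.iUnion h2)
  convert this using 1
  ext x
  simp [IsMarked]

/-- Given the earlier points, a union bound shows that the last one contributes a factor of mean at
most `1 + 255 * (μ A + m * c) ≤ 2`. -/
lemma lintegral_markWeight_le {μ : Measure Ω} [IsProbabilityMeasure μ] {A : Set Ω}
    {C : Set (Ω × Ω)} (hA : MeasurableSet A) (hC : MeasurableSet C) {c : ℝ≥0∞}
    (hc : ∀ x, μ {y | (x, y) ∈ C} ≤ c) (m : ℕ) (hm : 255 * (μ A + m * c) ≤ 1) :
    ∫⁻ x, markWeight A C m x ∂(Measure.pi fun _ : Fin m => μ) ≤ 2 ^ m := by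
  classical
  induction m with
  | zero => simp [markWeight]
  | succ m ih =>
    have hm' : 255 * (μ A + m * c) ≤ 1 := le_trans (by gcongr; simp) hm
    have hmp := (measurePreserving_piFinSuccAbove (fun _ : Fin (m + 1) => μ) (Fin.last m)).symm
    rw [← hmp.lintegral_comp (measurable_markWeight hA hC _), lintegral_prod_symm']
    · have key : ∀ x : Fin m → Ω, ∫⁻ y, markWeight A C (m + 1)
          ((MeasurableEquiv.piFinSuccAbove (fun _ => Ω) (Fin.last m)).symm (y, x)) ∂μ
          ≤ markWeight A C m x * 2 := by
        intro x
        have h1 : ∀ y, markWeight A C (m + 1)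
          ((MeasurableEquiv.piFinSuccAbove (fun _ => Ω) (Fin.last m)).symm (y, x)) =
            markWeight A C m x * if y ∈ A ∨ ∃ i, (x i, y) ∈ C then 256 else 1 := by
          intro y
          rw [← markWeight_succ]
          congr 1
          simp [MeasurableEquiv.piFinSuccAbove, Fin.insertNthEquiv, Fin.insertNth_last']
        have hmeas : MeasurableSet {y | y ∈ A ∨ ∃ i, (x i, y) ∈ C} := by
          have := hA.union (MeasurableSet.iUnion fun i => hC.preimage
            (measurable_prodMk_left (x := x i)))
          convert this using 1
          ext y
          simp
        simp_rw [h1]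
        rw [lintegral_const_mul _ (Measurable.ite hmeas measurable_const measurable_const)]
        gcongr
        have h2 : ∀ y, (if y ∈ A ∨ ∃ i, (x i, y) ∈ C then (256 : ℝ≥0∞) else 1) =
            1 + {y | y ∈ A ∨ ∃ i, (x i, y) ∈ C}.indicator (fun _ => 255) y := by
          intro y
          by_cases hy : y ∈ A ∨ ∃ i, (x i, y) ∈ C
          · rw [if_pos hy, Set.indicator_of_mem (s := {y | y ∈ A ∨ ∃ i, (x i, y) ∈ C}) hy]
            norm_num
          · rw [if_neg hy, Set.indicator_of_notMem (s := {y | y ∈ A ∨ ∃ i, (x i, y) ∈ C}) hy,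
              add_zero]
        simp_rw [h2]
        rw [lintegral_add_left measurable_const, lintegral_indicator_const hmeas, lintegral_one,
          measure_univ]
        have h3 : μ {y | y ∈ A ∨ ∃ i, (x i, y) ∈ C} ≤ μ A + m * c := by
          have : {y | y ∈ A ∨ ∃ i, (x i, y) ∈ C} ⊆ A ∪ ⋃ i, {y | (x i, y) ∈ C} := by
            rintro y (hy | ⟨i, hi⟩)
            · exact Or.inl hy
            · exact Or.inr (Set.mem_iUnion.2 ⟨i, hi⟩)
          refine (measure_mono this).trans ((measure_union_le _ _).trans ?_)
          gcongr
          refine (measure_iUnion_fintype_le _ _).trans ((Finset.sum_le_sum fun i _ => hc _).trans ?_)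
          simp
        calc 1 + 255 * μ {y | y ∈ A ∨ ∃ i, (x i, y) ∈ C} ≤ 1 + 255 * (μ A + m * c) := by gcongr
          _ ≤ 1 + 1 := by gcongr
          _ = 2 := by norm_num
      refine (lintegral_mono key).trans ?_
      rw [lintegral_mul_const _ (measurable_markWeight hA hC m), pow_succ]
      gcongr
      exact ih hm'
    · exact (measurable_markWeight hA hC _).comp (MeasurableEquiv.measurable _)

open Classical in
-- Markov's inequality for the weight `256 ^ k`, where `k` is the number of marks: the ratio of `2 ^
-- m` to the threshold `16 ^ m / 16` is the bound.
lemma measure_half_marked_le {μ : Measure Ω} [IsProbabilityMeasure μ] {A : Set Ω}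
    {C : Set (Ω × Ω)} (hA : MeasurableSet A) (hC : MeasurableSet C) {c : ℝ≥0∞}
    (hc : ∀ x, μ {y | (x, y) ∈ C} ≤ c) (m : ℕ) (hm : 255 * (μ A + m * c) ≤ 1) :
    Measure.infinitePi (fun _ : ℕ => μ) {x | m ≤
      2 * (Finset.univ.filter (IsMarked A C fun i : Fin m => x i)).card + 1} ≤
      16 * (1 / 8) ^ m := by
  have hmap : (Measure.infinitePi fun _ : ℕ => μ).map (fun x (i : Fin m) => x i) =
      Measure.pi fun _ : Fin m => μ := by
    rw [Measure.map_infinitePi_infinitePi_of_inj Fin.val_injective, Measure.infinitePi_eq_pi]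
  have hf : Measurable fun (x : ℕ → Ω) (i : Fin m) => x i := by fun_prop
  have hint := lintegral_markWeight_le hA hC hc m hm
  rw [← hmap, lintegral_map (measurable_markWeight hA hC m) hf] at hint
  -- If `m ≤ 2 k + 1` then `16 ^ m ≤ 16 * 256 ^ k`; the factor 16 pays for the vertex that may be
  -- left uncovered.
  have hmarkov := mul_meas_ge_le_lintegral (μ := Measure.infinitePi fun _ : ℕ => μ)
    ((measurable_markWeight hA hC m).comp hf) ((16 : ℝ≥0∞) ^ m / 16)
  have hsub : {x : ℕ → Ω | m ≤
      2 * (Finset.univ.filter (IsMarked A C fun i : Fin m => x i)).card + 1} ⊆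
      {x | (16 : ℝ≥0∞) ^ m / 16 ≤ (markWeight A C m ∘ fun x (i : Fin m) => x i) x} := by
    intro x hx
    rw [Set.mem_ofPred_eq] at hx ⊢
    refine ENNReal.div_le_of_le_mul ?_
    rw [Function.comp_apply, markWeight_eq_pow, show (256 : ℝ≥0∞) = 16 ^ 2 by norm_num, ← pow_mul,
      ← pow_succ]
    exact pow_le_pow_right₀ (by norm_num) hx
  have h := (mul_le_mul_right (measure_mono hsub) ((16 : ℝ≥0∞) ^ m / 16)).trans
    (hmarkov.trans hint)
  have h16 : (16 : ℝ≥0∞) ^ m / 16 * (16 * (1 / 16) ^ m) = 1 := by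
    rw [ENNReal.div_eq_inv_mul, one_div, ← ENNReal.inv_pow]
    rw [show ((16 : ℝ≥0∞)⁻¹ * 16 ^ m * (16 * (16 ^ m)⁻¹)) =
      ((16 : ℝ≥0∞)⁻¹ * 16) * (16 ^ m * (16 ^ m)⁻¹) by ring]
    rw [ENNReal.inv_mul_cancel (by norm_num) (by norm_num),
      ENNReal.mul_inv_cancel (by positivity) (by simp), one_mul]
  calc _ = (16 * (1 / 16) ^ m) * ((16 : ℝ≥0∞) ^ m / 16 * _) := by
        rw [← mul_assoc, mul_comm (16 * (1 / 16 : ℝ≥0∞) ^ m), h16, one_mul]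
    _ ≤ (16 * (1 / 16) ^ m) * 2 ^ m := by gcongr
    _ = 16 * (1 / 8) ^ m := by
        rw [mul_assoc, ← mul_pow]
        congr 2
        rw [show (16 : ℝ≥0∞) = 8 * 2 by norm_num, one_div, one_div,
          ENNReal.mul_inv (by norm_num) (by norm_num), mul_assoc,
          ENNReal.inv_mul_cancel (by norm_num) (by norm_num), mul_one]

end Exploration

/-! ### Geometry of adjacent points near the boundary -/

/-- The law of cosines reads `cosh d = cosh (r - r') + sinh r * sinh r' * (1 - cos (θ - θ'))`. The
left side is at most `exp R`, while each `sinh` is at least `exp (R - h) / 4`. -/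
lemma one_sub_cos_le_of_dist_le {R h : ℝ} (hR : h + 1 ≤ R) {p q : ℝ × ℝ} (hp : R - h < p.1)
    (hq : R - h < q.1) (hd : dist (polarPoint p) (polarPoint q) ≤ R) :
    1 - Real.cos (p.2 - q.2) ≤ 16 * Real.exp (2 * h - R) := by
  have hcosh : Real.cosh (dist (polarPoint p) (polarPoint q)) ≤ Real.cosh R :=
    Real.cosh_le_cosh.2 (by rwa [abs_of_nonneg dist_nonneg,
      abs_of_nonneg (dist_nonneg.trans hd)])
  rw [cosh_dist_polarPoint] at hcosh
  have h1 : 1 ≤ Real.cosh (p.1 - q.1) := Real.one_le_cosh _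
  rw [Real.cosh_sub] at h1
  have hcR : Real.cosh R ≤ Real.exp R := by
    rw [Real.cosh_eq]
    have : Real.exp (-R) ≤ Real.exp R :=
      Real.exp_le_exp.2 (by linarith [(dist_nonneg.trans hd : (0 : ℝ) ≤ R)])
    linarith
  -- Here `R - h ≥ 1` gives `exp (R - h) ≥ 2`, which absorbs the negative exponential in `sinh`.
  have hs : ∀ x, R - h < x → Real.exp (R - h) / 4 ≤ Real.sinh x := by
    intro x hx
    refine le_trans ?_ (Real.sinh_le_sinh.2 hx.le)
    rw [Real.sinh_eq]
    have h2 : Real.exp (-(R - h)) ≤ 1 := Real.exp_le_one_iff.2 (by linarith)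
    have h3 : R - h + 1 ≤ Real.exp (R - h) := Real.add_one_le_exp _
    linarith
  have hprod : Real.exp (R - h) / 4 * (Real.exp (R - h) / 4) ≤ Real.sinh p.1 * Real.sinh q.1 := by
    have := Real.exp_pos (R - h)
    exact mul_le_mul (hs _ hp) (hs _ hq) (by positivity)
      ((by positivity : (0 : ℝ) ≤ Real.exp (R - h) / 4).trans (hs _ hp))
  have hc := Real.cos_le_one (p.2 - q.2)
  have hmain : Real.exp (R - h) / 4 * (Real.exp (R - h) / 4) * (1 - Real.cos (p.2 - q.2)) ≤
      Real.exp R := by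
    have := mul_le_mul_of_nonneg_right hprod (sub_nonneg.2 hc)
    nlinarith
  have hE : Real.exp (R - h) * Real.exp (R - h) * Real.exp (2 * h - R) = Real.exp R := by
    rw [← Real.exp_add, ← Real.exp_add]
    congr 1
    ring
  have hpos : 0 < Real.exp (R - h) * Real.exp (R - h) := by positivity
  refine le_of_mul_le_mul_left ?_ hpos
  nlinarith

/-! ### Marginals of the quasi-uniform distribution -/

lemma quasiUniform_prod {α R : ℝ} (hα : 0 < α) (hR : 0 < R) {A B : Set ℝ} (hA : MeasurableSet A)
    (hB : MeasurableSet B) :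
    quasiUniform α R (A ×ˢ B) =
      (∫⁻ r in A ∩ Set.Ico 0 R, ENNReal.ofReal (α * Real.sinh (α * r) / (Real.cosh (α * R) - 1))) *
        (ENNReal.ofReal (1 / (2 * Real.pi)) * volume (B ∩ Set.Ioc 0 (2 * Real.pi))) := by
  have hC : 0 < Real.cosh (α * R) - 1 := by
    have := Real.one_lt_cosh.2 (mul_pos hα hR).ne'
    linarith
  have hpi := Real.pi_pos
  have hfun : (fun p : ℝ × ℝ => ENNReal.ofReal (density α R p)) =
      (Set.Ico 0 R ×ˢ Set.Ioc 0 (2 * Real.pi)).indicator (fun q : ℝ × ℝ =>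
        ENNReal.ofReal (α * Real.sinh (α * q.1) / (Real.cosh (α * R) - 1)) *
        ENNReal.ofReal (1 / (2 * Real.pi))) := by
    funext p
    by_cases hp : p ∈ Set.Ico 0 R ×ˢ Set.Ioc 0 (2 * Real.pi)
    · have h0 : 0 ≤ α * Real.sinh (α * p.1) / (Real.cosh (α * R) - 1) :=
        div_nonneg (mul_nonneg hα.le (Real.sinh_nonneg_iff.2 (mul_nonneg hα.le hp.1.1))) hC.le
      rw [density, Set.indicator_of_mem hp, Set.indicator_of_mem hp, ← ENNReal.ofReal_mul h0]
      congr 1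
      field_simp
    · rw [density, Set.indicator_of_notMem hp, Set.indicator_of_notMem hp, ENNReal.ofReal_zero]
  rw [quasiUniform, withDensity_apply _ (hA.prod hB), hfun,
    lintegral_indicator (measurableSet_Ico.prod measurableSet_Ioc),
    Measure.restrict_restrict (measurableSet_Ico.prod measurableSet_Ioc), Set.prod_inter_prod,
    Measure.volume_eq_prod, ← Measure.prod_restrict,
    lintegral_prod_mul (f := fun q : ℝ =>
      ENNReal.ofReal (α * Real.sinh (α * q) / (Real.cosh (α * R) - 1)))
      (g := fun _ : ℝ => ENNReal.ofReal (1 / (2 * Real.pi)))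
      (by fun_prop) (by fun_prop), lintegral_const, Measure.restrict_apply_univ,
    Set.inter_comm A, Set.inter_comm B]

lemma lintegral_radial_density {α R s : ℝ} (hα : 0 < α) (hR : 0 < R) (hs : 0 ≤ s) :
    ∫⁻ r in Set.Ioc 0 s, ENNReal.ofReal (α * Real.sinh (α * r) / (Real.cosh (α * R) - 1)) =
      ENNReal.ofReal ((Real.cosh (α * s) - 1) / (Real.cosh (α * R) - 1)) := by
  have hC : 0 < Real.cosh (α * R) - 1 := by
    have := Real.one_lt_cosh.2 (mul_pos hα hR).ne'
    linarith
  have hcont : Continuous fun q : ℝ => α * Real.sinh (α * q) / (Real.cosh (α * R) - 1) := by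
    fun_prop
  rw [← ofReal_integral_eq_lintegral_ofReal
    (hcont.integrableOn_Icc.mono_set Set.Ioc_subset_Icc_self)]
  · rw [← intervalIntegral.integral_of_le hs, intervalIntegral.integral_eq_sub_of_hasDerivAt
      (f := fun q => Real.cosh (α * q) / (Real.cosh (α * R) - 1))]
    · congr 1
      simp [sub_div]
    · intro x _
      have := (((hasDerivAt_id x).const_mul α).cosh).div_const (Real.cosh (α * R) - 1)
      simpa [mul_comm] using this
    · exact hcont.intervalIntegrable _ _
  · refine (ae_restrict_iff' measurableSet_Ioc).2 (ae_of_all _ fun x hx => ?_)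
    exact div_nonneg (mul_nonneg hα.le (Real.sinh_nonneg_iff.2 (mul_nonneg hα.le hx.1.le))) hC.le

lemma sinh_sub_le {x y : ℝ} (hy : 0 ≤ y) :
    Real.sinh (x - y) ≤ Real.exp (-y) * Real.sinh x := by
  rw [Real.sinh_eq, Real.sinh_eq, show -(x - y) = -x + y by ring, sub_eq_add_neg x y,
    Real.exp_add, Real.exp_add]
  have h1 : Real.exp (-y) ≤ Real.exp y := Real.exp_le_exp.2 (by linarith)
  nlinarith [Real.exp_pos (-x)]

lemma cosh_sub_one_eq (x : ℝ) : Real.cosh x - 1 = 2 * Real.sinh (x / 2) ^ 2 := by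
  have h1 := Real.cosh_two_mul (x / 2)
  rw [mul_div_cancel₀ _ (two_ne_zero), Real.cosh_sq] at h1
  linarith

/-- Writing `cosh x - 1` as `2 * sinh (x / 2) ^ 2` turns the radial mass into a squared ratio of
`sinh`s, so `sinh_sub_le` gives the exponential bound without an error term. -/
lemma quasiUniform_radius_le {α R h : ℝ} (hα : 0 < α) (hh : 0 ≤ h) (hR : 0 < R) (hhR : h ≤ R) :
    quasiUniform α R {p | p.1 ≤ R - h} ≤ ENNReal.ofReal (Real.exp (-(α * h))) := by
  have hpi := Real.pi_pos
  have hset : {p : ℝ × ℝ | p.1 ≤ R - h} = Set.Iic (R - h) ×ˢ Set.univ := by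
    ext p
    simp
  have hang : ENNReal.ofReal (1 / (2 * Real.pi)) * volume (Set.univ ∩ Set.Ioc 0 (2 * Real.pi))
      = 1 := by
    rw [Set.univ_inter, Real.volume_Ioc, sub_zero, ← ENNReal.ofReal_mul (by positivity),
      ← ENNReal.ofReal_one]
    congr 1
    field_simp
  rw [hset, quasiUniform_prod hα hR measurableSet_Iic .univ, hang, mul_one]
  have hsub : Set.Iic (R - h) ∩ Set.Ico 0 R ⊆ Set.Icc 0 (R - h) := fun x hx => ⟨hx.2.1, hx.1⟩
  refine (lintegral_mono_set hsub).trans ?_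
  rw [setLIntegral_congr Ioc_ae_eq_Icc.symm, lintegral_radial_density hα hR (by linarith)]
  refine ENNReal.ofReal_le_ofReal ?_
  rw [cosh_sub_one_eq, cosh_sub_one_eq]
  have hpos : 0 < Real.sinh (α * R / 2) := Real.sinh_pos_iff.2 (by positivity)
  rw [div_le_iff₀ (by positivity)]
  have h1 := sinh_sub_le (x := α * R / 2) (y := α * h / 2) (by positivity)
  rw [show α * R / 2 - α * h / 2 = α * (R - h) / 2 by ring] at h1
  have h0 : 0 ≤ Real.sinh (α * (R - h) / 2) :=
    Real.sinh_nonneg_iff.2 (by have := mul_nonneg hα.le (sub_nonneg.2 hhR); linarith)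
  have h2 := pow_le_pow_left₀ h0 h1 2
  rw [mul_pow, ← Real.exp_nat_mul, show ((2 : ℕ) : ℝ) * -(α * h / 2) = -(α * h) by
    push_cast; ring] at h2
  linarith

lemma volume_one_sub_cos_le (a : ℝ) {δ : ℝ} (hδ : 0 ≤ δ) :
    volume ({θ | 1 - Real.cos (a - θ) ≤ 2 * δ ^ 2} ∩ Set.Ioc 0 (2 * Real.pi)) ≤
      ENNReal.ofReal (2 * Real.pi * δ) := by
  have hpi := Real.pi_pos
  have hmeas : MeasurableSet {θ : ℝ | 1 - Real.cos (a - θ) ≤ 2 * δ ^ 2} :=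
    measurableSet_le (by fun_prop) (by fun_prop)
  -- By periodicity the window `(0, 2π]` may be replaced by one centred at `a`, where `cos t ≤ 1 - 2
  -- t² / π²` applies.
  have hinv : ∀ g : AddSubgroup.zmultiples (2 * Real.pi),
      (fun x => g +ᵥ x) ⁻¹' {θ : ℝ | 1 - Real.cos (a - θ) ≤ 2 * δ ^ 2} =
        {θ : ℝ | 1 - Real.cos (a - θ) ≤ 2 * δ ^ 2} := by
    rintro ⟨_, k, rfl⟩
    ext x
    have : a - (k • (2 * Real.pi) + x) = a - x - k * (2 * Real.pi) := by
      rw [zsmul_eq_mul]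
      ring
    simp only [Set.mem_preimage, Set.mem_ofPred_eq, AddSubgroup.vadd_def, vadd_eq_add]
    rw [this, Real.cos_sub_int_mul_two_pi]
  have h := (isAddFundamentalDomain_Ioc Real.two_pi_pos 0).measure_set_eq
    (isAddFundamentalDomain_Ioc Real.two_pi_pos (a - Real.pi)) hmeas hinv
  rw [zero_add] at h
  rw [h]
  have hsub : {θ | 1 - Real.cos (a - θ) ≤ 2 * δ ^ 2} ∩
      Set.Ioc (a - Real.pi) (a - Real.pi + 2 * Real.pi) ⊆
      Set.Icc (a - Real.pi * δ) (a + Real.pi * δ) := by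
    rintro θ ⟨h1, h2, h3⟩
    rw [Set.mem_ofPred_eq] at h1
    have h4 : |a - θ| ≤ Real.pi := abs_le.2 ⟨by linarith, by linarith⟩
    have h5 := Real.cos_le_one_sub_mul_cos_sq h4
    have h6 : (a - θ) ^ 2 ≤ (Real.pi * δ) ^ 2 := by
      have h7 : 2 / Real.pi ^ 2 * (a - θ) ^ 2 ≤ 2 * δ ^ 2 := by linarith
      rw [div_mul_eq_mul_div, div_le_iff₀ (by positivity)] at h7
      nlinarith
    have h7 := abs_le.1 (abs_le_of_sq_le_sq h6 (by positivity))
    exact ⟨by linarith, by linarith⟩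
  refine (measure_mono hsub).trans ?_
  rw [Real.volume_Icc]
  exact ENNReal.ofReal_le_ofReal (by linarith)

lemma quasiUniform_angle_le {α R : ℝ} (hα : 0 < α) (hR : 0 < R) (a : ℝ) {δ : ℝ} (hδ : 0 ≤ δ) :
    quasiUniform α R {p | 1 - Real.cos (a - p.2) ≤ 2 * δ ^ 2} ≤ ENNReal.ofReal δ := by
  have hpi := Real.pi_pos
  have hC : 0 < Real.cosh (α * R) - 1 := by
    have := Real.one_lt_cosh.2 (mul_pos hα hR).ne'
    linarith
  have hmeas : MeasurableSet {θ : ℝ | 1 - Real.cos (a - θ) ≤ 2 * δ ^ 2} :=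
    measurableSet_le (by fun_prop) (by fun_prop)
  have hset : {p : ℝ × ℝ | 1 - Real.cos (a - p.2) ≤ 2 * δ ^ 2} =
      Set.univ ×ˢ {θ : ℝ | 1 - Real.cos (a - θ) ≤ 2 * δ ^ 2} := by
    ext p
    simp
  have hrad : ∫⁻ r in Set.univ ∩ Set.Ico 0 R,
      ENNReal.ofReal (α * Real.sinh (α * r) / (Real.cosh (α * R) - 1)) = 1 := by
    rw [Set.univ_inter, setLIntegral_congr Ico_ae_eq_Ioc, lintegral_radial_density hα hR hR.le,
      div_self hC.ne', ENNReal.ofReal_one]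
  rw [hset, quasiUniform_prod hα hR .univ hmeas, hrad, one_mul]
  calc _ ≤ ENNReal.ofReal (1 / (2 * Real.pi)) * ENNReal.ofReal (2 * Real.pi * δ) := by
        gcongr
        exact volume_one_sub_cos_le a hδ
    _ = ENNReal.ofReal δ := by
        rw [← ENNReal.ofReal_mul (by positivity)]
        congr 1
        field_simp

/-! ### Poisson mixtures -/

lemma hasSum_poisson_mul_pow (n : ℕ) (t : ℝ) :
    HasSum (fun m : ℕ => Real.exp (-n) * n ^ m / m.factorial * t ^ m)
      (Real.exp (-n) * Real.exp (n * t)) := by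
  have := (NormedSpace.expSeries_div_hasSum_exp ((n : ℝ) * t)).mul_left (Real.exp (-n))
  rw [← Real.exp_eq_exp_ℝ] at this
  refine (funext fun m => ?_ : (fun m : ℕ => _) = fun m : ℕ => _) ▸ this
  rw [mul_pow]
  ring

/-- For `m > 2n` the trivial bound 1 is replaced by `4 ^ (-n) * 2 ^ m`, a Chernoff bound for the
Poisson tail. Both terms are then geometric in `m` and sum through the Poisson generating function.
Countable subadditivity over the slices spares any measurability of `E`. -/
lemma poissonLaw_le_of_slice_le {n : ℕ} {α ν : ℝ} (hα : 0 < α) (hR : 0 < radius n ν)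
    (E : Set (ℕ × (ℕ → ℝ × ℝ)))
    (hE : ∀ m ≤ 2 * n, Measure.infinitePi (fun _ : ℕ => quasiUniform α (radius n ν))
      {x | (m, x) ∈ E} ≤ 16 * (1 / 8) ^ m) :
    poissonLaw n α ν E ≤
      ENNReal.ofReal (16 * Real.exp (-(7 / 8) * n) + Real.exp (-(Real.log 4 - 1) * n)) := by
  have := isProbabilityMeasure_quasiUniform hα hR
  set P := Measure.infinitePi (fun _ : ℕ => quasiUniform α (radius n ν))
  have hslice : ∀ m, P {x | (m, x) ∈ E} ≤
      ENNReal.ofReal (16 * (1 / 8) ^ m + (1 / 4) ^ n * 2 ^ m) := by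
    intro m
    rcases le_or_gt m (2 * n) with h | h
    · refine (hE m h).trans ?_
      have : (16 * (1 / 8) ^ m : ℝ≥0∞) = ENNReal.ofReal (16 * (1 / 8) ^ m) := by
        rw [ENNReal.ofReal_mul (by norm_num), ENNReal.ofReal_pow (by norm_num),
          ENNReal.ofReal_div_of_pos (by norm_num)]
        simp
      rw [this]
      exact ENNReal.ofReal_le_ofReal (le_add_of_nonneg_right (by positivity))
    · refine prob_le_one.trans ?_
      rw [← ENNReal.ofReal_one]
      refine ENNReal.ofReal_le_ofReal ?_
      have h1 : (2 : ℝ) ^ (2 * n) ≤ 2 ^ m := pow_le_pow_right₀ (by norm_num) h.le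
      have h2 : (1 / 4 : ℝ) ^ n * 2 ^ (2 * n) = 1 := by
        rw [pow_mul, ← mul_pow]
        norm_num
      have h3 : (1 / 4 : ℝ) ^ n * 2 ^ (2 * n) ≤ (1 / 4 : ℝ) ^ n * 2 ^ m := by gcongr
      have h4 : (0 : ℝ) ≤ 16 * (1 / 8) ^ m := by positivity
      linarith
  have hcover : E ⊆ ⋃ m : ℕ, {m} ×ˢ {x | (m, x) ∈ E} := by
    rintro ⟨m, x⟩ h
    exact Set.mem_iUnion.2 ⟨m, rfl, h⟩
  have hsum := ((hasSum_poisson_mul_pow n (1 / 8)).mul_left 16).add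
    ((hasSum_poisson_mul_pow n 2).mul_left ((1 / 4) ^ n))
  calc poissonLaw n α ν E ≤ ∑' m : ℕ, poissonLaw n α ν ({m} ×ˢ {x | (m, x) ∈ E}) :=
        (measure_mono hcover).trans (measure_iUnion_le _)
    _ ≤ ∑' m : ℕ, ENNReal.ofReal (16 * (Real.exp (-n) * n ^ m / m.factorial * (1 / 8) ^ m) +
          (1 / 4) ^ n * (Real.exp (-n) * n ^ m / m.factorial * 2 ^ m)) := by
        refine ENNReal.tsum_le_tsum fun m => ?_
        rw [poissonLaw, Measure.prod_prod, poissonMeasure_singleton]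
        refine (mul_le_mul_right (hslice m) _).trans ?_
        rw [← ENNReal.ofReal_mul (by positivity)]
        refine ENNReal.ofReal_le_ofReal (le_of_eq ?_)
        simp only [NNReal.coe_natCast]
        ring
    _ = ENNReal.ofReal (16 * Real.exp (-(7 / 8) * n) + Real.exp (-(Real.log 4 - 1) * n)) := by
        rw [← ENNReal.ofReal_tsum_of_nonneg (fun m => by positivity) hsum.summable, hsum.tsum_eq]
        congr 1
        rw [← Real.exp_add, ← Real.exp_add]
        congr 1
        · congr 2
          ring
        · have : (1 / 4 : ℝ) ^ n = Real.exp (-Real.log 4 * n) := by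
            rw [mul_comm, Real.exp_nat_mul, Real.exp_neg, Real.exp_log (by norm_num), one_div]
          rw [this, ← Real.exp_add]
          congr 1
          ring

/-! ### Near perfect matchings are unlikely -/

/-- Each of the two reasons for a mark is allowed probability 1/510, together 1/255. Depth uses `510
≤ exp (α h)`; closeness to one of at most `2n` earlier points uses `2n * δ = 6 * exp h * ν ≤ 1/510`,
whence `3060 = 6 * 510`. -/
lemma measure_hasNearPerfectMatching_le {n m : ℕ} {α ν h : ℝ} (hα : 0 < α) (hν : 0 < ν)
    (hn : 0 < n) (hh : 0 ≤ h) (hhα : 510 ≤ Real.exp (α * h)) (hνh : 3060 * (Real.exp h * ν) ≤ 1)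
    (hR : h + 1 ≤ radius n ν) (hm : m ≤ 2 * n) :
    Measure.infinitePi (fun _ : ℕ => quasiUniform α (radius n ν))
      {x | HasNearPerfectMatching (poissonGraph (radius n ν) (m, x))} ≤ 16 * (1 / 8) ^ m := by
  classical
  have hn' : (0 : ℝ) < n := Nat.cast_pos.2 hn
  have hR0 : 0 < radius n ν := by linarith
  have := isProbabilityMeasure_quasiUniform hα hR0
  set δ : ℝ := 3 * Real.exp h * ν / n with hδ
  have hδ0 : 0 ≤ δ := by positivity
  set A : Set (ℝ × ℝ) := {p | p.1 ≤ radius n ν - h} with hA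
  set C : Set ((ℝ × ℝ) × (ℝ × ℝ)) := {pq | 1 - Real.cos (pq.1.2 - pq.2.2) ≤ 2 * δ ^ 2} with hC
  have hAm : MeasurableSet A := measurableSet_le (by fun_prop) (by fun_prop)
  have hCm : MeasurableSet C := measurableSet_le (by fun_prop) (by fun_prop)
  -- Since `exp (-R) = (ν / n) ^ 2`, the factor 3 in `δ` reduces this to `16 ≤ 18`.
  have hεδ : 16 * Real.exp (2 * h - radius n ν) ≤ 2 * δ ^ 2 := by
    have h1 : Real.exp (radius n ν) = (n / ν) ^ 2 := by
      rw [radius, two_mul, Real.exp_add, Real.exp_log (by positivity)]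
      ring
    have h2 : Real.exp (2 * h) = Real.exp h ^ 2 := by
      rw [two_mul, Real.exp_add]
      ring
    have h3 : 2 * δ ^ 2 = 18 * (Real.exp h ^ 2 / (n / ν) ^ 2) := by
      rw [hδ]
      field_simp
      norm_num
    rw [Real.exp_sub, h1, h2, h3]
    gcongr
    norm_num
  refine le_trans (measure_mono ?_) (measure_half_marked_le (μ := quasiUniform α (radius n ν))
    hAm hCm (c := ENNReal.ofReal δ)
    (fun p => quasiUniform_angle_le hα hR0 p.2 hδ0) m ?_)
  · intro x hx
    have hcov := HasNearPerfectMatching.card_le hx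
      (Finset.univ.filter (IsMarked A C fun i : Fin m => x i)) ?_
    · simpa using hcov
    -- An edge between two points outside `A` marks its later endpoint, so the marked points form a
    -- vertex cover.
    have key : ∀ i j : Fin m, i < j → dist (polarPoint (x i)) (polarPoint (x j)) ≤ radius n ν →
        IsMarked A C (fun i : Fin m => x i) i ∨ IsMarked A C (fun i : Fin m => x i) j := by
      intro i j hij hd
      by_cases hi : x i ∈ A
      · exact Or.inl (Or.inl hi)
      by_cases hj : x j ∈ A
      · exact Or.inr (Or.inl hj)
      refine Or.inr (Or.inr ⟨i, hij, ?_⟩)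
      exact (one_sub_cos_le_of_dist_le hR (not_le.1 hi) (not_le.1 hj) hd).trans hεδ
    intro i j hij
    simp only [Finset.mem_filter, Finset.mem_univ, true_and]
    rcases lt_or_gt_of_ne hij.1 with h | h
    · exact key i j h hij.2
    · refine (key j i h ?_).symm
      rw [dist_comm]
      exact hij.2
  · have h1 : quasiUniform α (radius n ν) A ≤ ENNReal.ofReal (1 / 510) := by
      refine (quasiUniform_radius_le hα hh hR0 (by linarith)).trans
        (ENNReal.ofReal_le_ofReal ?_)
      rw [Real.exp_neg, ← one_div]
      exact one_div_le_one_div_of_le (by norm_num) hhα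
    have h2 : (m : ℝ≥0∞) * ENNReal.ofReal δ ≤ ENNReal.ofReal (1 / 510) := by
      rw [← ENNReal.ofReal_natCast, ← ENNReal.ofReal_mul (by positivity)]
      refine ENNReal.ofReal_le_ofReal ?_
      have h3 : (m : ℝ) ≤ 2 * n := by exact_mod_cast hm
      calc (m : ℝ) * δ ≤ 2 * n * δ := by gcongr
        _ = 6 * (Real.exp h * ν) := by
          rw [hδ]
          field_simp
          norm_num
        _ ≤ 1 / 510 := by linarith
    calc 255 * (quasiUniform α (radius n ν) A + m * ENNReal.ofReal δ)
        ≤ ENNReal.ofReal 255 * (ENNReal.ofReal (1 / 510) + ENNReal.ofReal (1 / 510)) := by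
          rw [show ENNReal.ofReal 255 = 255 by simp]
          gcongr
      _ = 1 := by
          rw [← ENNReal.ofReal_add (by norm_num) (by norm_num),
            ← ENNReal.ofReal_mul (by norm_num), ← ENNReal.ofReal_one]
          norm_num

/-! ### Asymptotics in `n` and the choice of `ν₀` -/

lemma tendsto_radius {ν : ℝ} (hν : 0 < ν) : Tendsto (fun n : ℕ => radius n ν) atTop atTop :=
  (Real.tendsto_log_atTop.comp
    (tendsto_natCast_atTop_atTop.atTop_div_const hν)).const_mul_atTop two_pos

lemma isLittleO_exp_neg_mul_natCast_rpow {b : ℝ} (hb : 0 < b) (s : ℝ) :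
    (fun n : ℕ => Real.exp (-b * n)) =o[atTop] (fun n : ℕ => (n : ℝ) ^ s) :=
  (isLittleO_exp_neg_mul_rpow_atTop hb s).comp_tendsto tendsto_natCast_atTop_atTop

lemma one_lt_log_four : 1 < Real.log 4 := by
  rw [Real.lt_log_iff_exp_lt (by norm_num)]
  linarith [Real.exp_one_lt_d9]

end

end KPKVB

theorem mainTheorem2 (α : ℝ) (hα0 : 0 < α) (hα : α < 1 / 2) :
    ∃ ν₀ : ℝ, 0 < ν₀ ∧ ∀ ν : ℝ, 0 < ν → ν < ν₀ →
      (fun n : ℕ => 1 - (KPKVB.poissonLaw n α ν).real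
        {ω | ¬ KPKVB.HasNearPerfectMatching (KPKVB.poissonGraph (KPKVB.radius n ν) ω)})
      =o[atTop] (fun n : ℕ => (n : ℝ) ^ (-(1 / 2) : ℝ)) := by
  -- The depth at which `exp (α h) = 510`; `ν₀` is then `exp (-h) / 3060`.
  set h : ℝ := Real.log 510 / α with hh
  have hh0 : 0 ≤ h := div_nonneg (Real.log_nonneg (by norm_num)) hα0.le
  have hhα : 510 ≤ Real.exp (α * h) := by
    rw [hh, mul_div_cancel₀ _ hα0.ne', Real.exp_log (by norm_num)]
  refine ⟨1 / (3060 * Real.exp h), by positivity, fun ν hν hν₀ => ?_⟩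
  have hνh : 3060 * (Real.exp h * ν) ≤ 1 := by
    rw [lt_div_iff₀ (by positivity)] at hν₀
    linarith
  refine IsBigO.trans_isLittleO ?_ (((KPKVB.isLittleO_exp_neg_mul_natCast_rpow
    (by norm_num : (0 : ℝ) < 7 / 8) _).const_mul_left 16).add
    (KPKVB.isLittleO_exp_neg_mul_natCast_rpow (sub_pos.2 KPKVB.one_lt_log_four) _))
  refine IsBigO.of_bound 1 ?_
  filter_upwards [(KPKVB.tendsto_radius hν).eventually_ge_atTop (h + 1), eventually_gt_atTop 0]
    with n hR hn
  have hR0 : 0 < KPKVB.radius n ν := by linarith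
  have := KPKVB.isProbabilityMeasure_quasiUniform hα0 hR0
  have hP : IsProbabilityMeasure (KPKVB.poissonLaw n α ν) := by
    unfold KPKVB.poissonLaw
    infer_instance
  set E := {ω | KPKVB.HasNearPerfectMatching (KPKVB.poissonGraph (KPKVB.radius n ν) ω)} with hE
  have hle := KPKVB.poissonLaw_le_of_slice_le hα0 hR0 E fun m hm =>
    KPKVB.measure_hasNearPerfectMatching_le hα0 hν hn hh0 hhα hνh hR hm
  have hle' := ENNReal.toReal_le_of_le_ofReal (by positivity) hle
  -- Subadditivity suffices for `1 - P(Eᶜ) ≤ P(E)`, so `E` need not be shown measurable.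
  have h1 : 1 ≤ (KPKVB.poissonLaw n α ν).real E + (KPKVB.poissonLaw n α ν).real Eᶜ := by
    have := measureReal_union_le (μ := KPKVB.poissonLaw n α ν) E Eᶜ
    rwa [Set.union_compl_self, probReal_univ] at this
  have h2 : (KPKVB.poissonLaw n α ν).real Eᶜ ≤ 1 := measureReal_le_one
  change ‖1 - (KPKVB.poissonLaw n α ν).real Eᶜ‖ ≤ _
  rw [one_mul, Real.norm_of_nonneg (by linarith), Real.norm_of_nonneg (by positivity)]
  rw [← measureReal_def] at hle'
  linarith
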